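/- Let $G=(V,E)$ be a finite simple graph, and let $(e_v)_{v\in V}$ be the canonical basis of $\mathbb{R}^V$. Let $Z_G=\sum_{\{u,v\}\in E}[e_u,e_v]\subset\mathbb{R}^V$ be the graphical zonotope of $G$ (a Minkowski sum of segments, equal to $\{0\}$ if $E=\varnothing$). Its deformation cone $\mathbb{DC}(Z_G)$ is the set of all polytopes $P\subset\mathbb{R}^V$ that are weak Minkowski summands of $Z_G$, that is, such that $P+Q=\lambda Z_G$ for some real $\lambda\ge 0$ and some polytope $Q\subset\mathbb{R}^V$. For $h\in\mathbb{R}^{2^V}$ let $$P_h=\Bigl\{x\in\mathbb{R}^V:\ \sum_{v\in S}x_v-\sum_{v\notin S}x_v\le h_S\ \text{ for all } S\subseteq V\Bigr\}.$$ Then $\mathbb{DC}(Z_G)$ is the set of the polytopes $P_h$ for all $h$ in the cone of $\mathbb{R}^{2^V}$ defined by the following conditions: - $h_\varnothing=-h_V$; - $h_{S\cup\{u\}}+h_{S\cup\{v\}}=h_S+h_{S\cup\{u,v\}}$ for all $u\neq v$ in $V$ with $\{u,v\}\notin E$ and all $S\subseteq V\setminus\{u,v\}$; - $h_{S\cup\{u\}}+h_{S\cup\{v\}}\ge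 h_S+h_{S\cup\{u,v\}}$ for all $\{u,v\}\in E$ and all $S\subseteq V\setminus\{u,v\}$. -/

import Mathlib

open scoped Pointwise

/-- A polytope: the convex hull of finitely many points. -/
def IsPolytope {V : Type*} (P : Set (V → ℝ)) : Prop :=
  ∃ F : Finset (V → ℝ), P = convexHull ℝ (F : Set (V → ℝ))

/-- `P` is a weak Minkowski summand of `R`: there are `c ≥ 0` and a polytope `Q` such that
the Minkowski sum `P + Q` is the dilate `c • R`. -/
def IsWeakMinkowskiSummand {V : Type*} (P R : Set (V → ℝ)) : Prop :=
  ∃ c : ℝ, 0 ≤ c ∧ ∃ Q : Set (V → ℝ), IsPolytope Q ∧ P + Q = c • R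

/-- The deformation cone of `R`: the set of all polytopes that are weak Minkowski summands
of `R`. -/
def deformationCone {V : Type*} (R : Set (V → ℝ)) : Set (Set (V → ℝ)) :=
  {P | IsPolytope P ∧ IsWeakMinkowskiSummand P R}

/-- The segment `[e_u, e_v]` between two canonical basis vectors, for the unordered pair
`{u, v}`. -/
def edgeSegment {V : Type*} [DecidableEq V] : Sym2 V → Set (V → ℝ) :=
  Sym2.lift ⟨fun u v => segment ℝ (Pi.single u (1 : ℝ)) (Pi.single v (1 : ℝ)),
    fun _ _ => segment_symm ℝ _ _⟩

/-- The graphical zonotope of `G`: the Minkowski sum of the segments `[e_u, e_v]` over all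
edges `{u, v}` of `G` (the empty sum is the origin). -/
def graphicalZonotope {V : Type*} [Fintype V] [DecidableEq V] (G : SimpleGraph V)
    [DecidableRel G.Adj] : Set (V → ℝ) :=
  ∑ e ∈ G.edgeFinset, edgeSegment e

/-- The deformed permutahedron with height vector `h`, one height for each subset of `V`. -/
def deformedPermutahedron {V : Type*} [Fintype V] [DecidableEq V] (h : Finset V → ℝ) :
    Set (V → ℝ) :=
  {x | ∀ S : Finset V, ∑ v ∈ S, x v - ∑ v ∈ Sᶜ, x v ≤ h S}

/-! Objectives that order the endpoints of every edge compatibly have a common maximizer on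
`graphicalZonotope G`: choose the same endpoint of each segment. This passes to any weak summand `P`
(`exists_forall_dotProduct_le_summand`). For the support heights of `P`, common maximizers at
suitable pairs of sign vectors give the (in)equalities. Along a chain of sets they give a point of
`P` maximizing any objective sorted by that chain, so `P` fills `deformedPermutahedron h`.

Conversely, heights in the cone are submodular, so Edmonds' greedy vectors span the polytope. Being
linear in `h`, they make Minkowski addition match addition of heights. The zonotope height is
strictly submodular at edges, so a large multiple of it minus `h` stays in the cone and supplies the
complementary summand. -/

/-- The vector equal to `1` on `S` and to `-1` off `S`. -/
def signVector {V : Type*} [DecidableEq V] (S : Finset V) : V → ℝ :=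
  fun v => if v ∈ S then 1 else -1

/-- The heights satisfying the (in)equalities indexed by the pairs of vertices of `G`. -/
def heightCone {V : Type*} [Fintype V] [DecidableEq V] (G : SimpleGraph V) :
    Set (Finset V → ℝ) :=
  {h : Finset V → ℝ |
        h ∅ = - h Finset.univ ∧
        (∀ u v : V, u ≠ v → ¬ G.Adj u v → ∀ S : Finset V, u ∉ S → v ∉ S →
          h (S ∪ {u}) + h (S ∪ {v}) = h S + h (S ∪ {u, v})) ∧
        (∀ u v : V, G.Adj u v → ∀ S : Finset V, u ∉ S → v ∉ S →
          h (S ∪ {u}) + h (S ∪ {v}) ≥ h S + h (S ∪ {u, v}))}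

/-- The elements among the first `k` in the enumeration `e`. -/
def initialSegment {V : Type*} [Fintype V] {n : ℕ} (e : V ≃ Fin n) (k : ℕ) : Finset V :=
  Finset.univ.filter fun v => (e v : ℕ) < k

/-- The greedy vector of the height `h` along the enumeration `e`. -/
noncomputable def greedyVector {V : Type*} [Fintype V] {n : ℕ} (h : Finset V → ℝ)
    (e : V ≃ Fin n) : V → ℝ :=
  fun v => (h (initialSegment e (e v + 1)) - h (initialSegment e (e v))) / 2

/-- The height of the graphical zonotope: each edge counts `1` if it meets `S`, else `-1`. -/
def zonotopeHeight {V : Type*} [Fintype V] [DecidableEq V] (G : SimpleGraph V)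
    [DecidableRel G.Adj] (S : Finset V) : ℝ :=
  ∑ e ∈ G.edgeFinset, if ∃ a ∈ S, a ∈ e then 1 else -1

section

set_option linter.unusedSectionVars false

variable {V : Type*} [Fintype V] [DecidableEq V]

/-! ### Sign vectors and the inequalities of `deformedPermutahedron` -/

theorem signVector_dotProduct (S : Finset V) (x : V → ℝ) :
    signVector S ⬝ᵥ x = ∑ v ∈ S, x v - ∑ v ∈ Sᶜ, x v := by
  rw [dotProduct, ← Finset.sum_add_sum_compl S, sub_eq_add_neg, ← Finset.sum_neg_distrib]
  congr 1
  · exact Finset.sum_congr rfl fun v hv => by simp [signVector, hv]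
  · exact Finset.sum_congr rfl fun v hv => by simp [signVector, Finset.mem_compl.1 hv]

theorem signVector_dotProduct' (S : Finset V) (x : V → ℝ) :
    signVector S ⬝ᵥ x = 2 * ∑ v ∈ S, x v - ∑ v, x v := by
  rw [signVector_dotProduct, ← Finset.sum_add_sum_compl S]
  ring

theorem signVector_le_iff {S : Finset V} {a b : V} :
    signVector S a ≤ signVector S b ↔ (a ∈ S → b ∈ S) := by
  by_cases ha : a ∈ S <;> by_cases hb : b ∈ S <;> norm_num [signVector, ha, hb]

theorem mem_deformedPermutahedron {h : Finset V → ℝ} {x : V → ℝ} :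
    x ∈ deformedPermutahedron h ↔ ∀ S, signVector S ⬝ᵥ x ≤ h S := by
  simp only [signVector_dotProduct]; rfl

theorem sum_eq_of_mem_deformedPermutahedron {h : Finset V → ℝ} {x : V → ℝ}
    (h0 : h ∅ = - h Finset.univ) (hx : x ∈ deformedPermutahedron h) :
    ∑ v, x v = h Finset.univ := by
  have h1 := hx ∅
  have h2 := hx Finset.univ
  simp only [Finset.sum_empty, Finset.compl_empty, Finset.compl_univ] at h1 h2
  linarith

theorem convex_deformedPermutahedron (h : Finset V → ℝ) :
    Convex ℝ (deformedPermutahedron h) := by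
  intro x hx y hy a b ha hb hab
  rw [mem_deformedPermutahedron] at *
  intro S
  rw [dotProduct_add, dotProduct_smul, dotProduct_smul, smul_eq_mul, smul_eq_mul]
  calc _ ≤ a * h S + b * h S :=
        add_le_add (mul_le_mul_of_nonneg_left (hx S) ha) (mul_le_mul_of_nonneg_left (hy S) hb)
    _ = h S := by rw [← add_mul, hab, one_mul]

/-! ### Enumerations and summation by parts -/

theorem exists_equiv_fin_antitone (w : V → ℝ) :
    ∃ e : V ≃ Fin (Fintype.card V), ∀ u v, e u ≤ e v → w v ≤ w u := by
  let e₀ := Fintype.equivFin V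
  let σ := Tuple.sort fun i => -w (e₀.symm i)
  refine ⟨e₀.trans σ.symm, fun u v huv => ?_⟩
  have := Tuple.monotone_sort (fun i => -w (e₀.symm i)) huv
  simpa [σ] using this

/-- Abel summation: the two sides differ by the sum of the terms `(W i - W (i + 1)) * d (i + 1)`
over `i < k`. -/
theorem sum_range_mul_sub_ge (W d : ℕ → ℝ) (h0 : d 0 = 0) (hd : ∀ k, 0 ≤ d k) (k : ℕ)
    (hW : ∀ i < k, W (i + 1) ≤ W i) :
    W k * d (k + 1) ≤ ∑ i ∈ Finset.range (k + 1), W i * (d (i + 1) - d i) := by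
  induction k with
  | zero => simp [h0]
  | succ k ih =>
    rw [Finset.sum_range_succ]
    have h1 := ih fun i hi => hW i (by omega)
    have h2 := mul_le_mul_of_nonneg_right (hW k (by omega)) (hd (k + 1))
    linarith

theorem initialSegment_zero {n : ℕ} (e : V ≃ Fin n) : initialSegment e 0 = ∅ := by
  simp [initialSegment]

theorem initialSegment_top {n : ℕ} (e : V ≃ Fin n) : initialSegment e n = Finset.univ := by
  simp [initialSegment]

theorem initialSegment_succ {n : ℕ} (e : V ≃ Fin n) (i : Fin n) :
    initialSegment e (i + 1) = insert (e.symm i) (initialSegment e i) := by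
  ext v
  simp only [initialSegment, Finset.mem_filter, Finset.mem_univ, true_and, Finset.mem_insert,
    Equiv.eq_symm_apply, Fin.ext_iff]
  omega

theorem symm_notMem_initialSegment {n : ℕ} (e : V ≃ Fin n) (i : Fin n) :
    e.symm i ∉ initialSegment e i := by
  simp [initialSegment]

theorem dotProduct_nonneg_of_initialSegment {n : ℕ} (e : V ≃ Fin n) {w z : V → ℝ}
    (hw : ∀ u v, e u ≤ e v → w v ≤ w u)
    (hz : ∀ k, 0 ≤ ∑ v ∈ initialSegment e k, z v) (hz0 : ∑ v, z v = 0) :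
    0 ≤ w ⬝ᵥ z := by
  obtain _ | n := n
  · have : IsEmpty V := e.isEmpty
    simp [dotProduct]
  -- The value `0` beyond `n` is never compared: monotonicity is needed only up to index `n`.
  let W : ℕ → ℝ := fun k => if hk : k < n + 1 then w (e.symm ⟨k, hk⟩) else 0
  let d : ℕ → ℝ := fun k => ∑ v ∈ initialSegment e k, z v
  have key : w ⬝ᵥ z = ∑ i ∈ Finset.range (n + 1), W i * (d (i + 1) - d i) := by
    rw [Finset.sum_range, dotProduct, ← e.symm.sum_comp]
    refine Finset.sum_congr rfl fun i _ => ?_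
    simp only [d, W]
    rw [initialSegment_succ, Finset.sum_insert (symm_notMem_initialSegment e i)]
    simp [i.2]
  rw [key]
  refine le_trans ?_ (sum_range_mul_sub_ge W d ?_ hz n ?_)
  · simp [d, initialSegment_top, hz0]
  · simp [d, initialSegment_zero]
  · intro i hi
    simp only [W, Nat.lt_succ_of_lt hi, Nat.succ_lt_succ hi, dif_pos]
    apply hw
    simp [Fin.le_def]

/-- Optimality certificate: a sorted `w` is a nonnegative combination of indicators of initial
segments, up to a constant vector, and coordinate sums are fixed. -/
theorem dotProduct_le_of_tight {n : ℕ} (e : V ≃ Fin n) {w p x : V → ℝ} {h : Finset V → ℝ}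
    (h0 : h ∅ = - h Finset.univ) (hw : ∀ u v, e u ≤ e v → w v ≤ w u)
    (hp : p ∈ deformedPermutahedron h)
    (hpe : ∀ k, signVector (initialSegment e k) ⬝ᵥ p = h (initialSegment e k))
    (hx : x ∈ deformedPermutahedron h) : w ⬝ᵥ x ≤ w ⬝ᵥ p := by
  have hps := sum_eq_of_mem_deformedPermutahedron h0 hp
  have hxs := sum_eq_of_mem_deformedPermutahedron h0 hx
  have := dotProduct_nonneg_of_initialSegment e (w := w) (z := p - x) hw (fun k => ?_) ?_
  · rw [dotProduct_sub] at this
    linarith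
  · have h1 := mem_deformedPermutahedron.1 hx (initialSegment e k)
    rw [← hpe, signVector_dotProduct', signVector_dotProduct'] at h1
    simp only [Pi.sub_apply, Finset.sum_sub_distrib]
    linarith
  · simp only [Pi.sub_apply, Finset.sum_sub_distrib, hps, hxs, sub_self]

theorem mem_of_forall_dotProduct_le {P : Set (V → ℝ)} (hc : Convex ℝ P) (hcl : IsClosed P)
    {x : V → ℝ} (H : ∀ w : V → ℝ, ∃ p ∈ P, w ⬝ᵥ x ≤ w ⬝ᵥ p) : x ∈ P := by
  by_contra hx
  obtain ⟨f, u, hf, hu⟩ := geometric_hahn_banach_closed_point hc hcl hx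
  have hfw (y : V → ℝ) : f y = (fun v => f (Pi.single v 1)) ⬝ᵥ y := by
    have := LinearMap.pi_apply_eq_sum_univ (f : (V → ℝ) →ₗ[ℝ] ℝ) y
    simp only [ContinuousLinearMap.coe_coe, smul_eq_mul] at this
    rw [this, dotProduct]
    refine Finset.sum_congr rfl fun v _ => ?_
    rw [mul_comm]
    congr 2
    ext j
    simp [Pi.single_apply, eq_comm]
  obtain ⟨p, hp, hxp⟩ := H fun v => f (Pi.single v 1)
  rw [← hfw, ← hfw] at hxp
  linarith [hf p hp]

/-! ### Polytopes and simultaneous maximizers -/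

theorem IsPolytope.isCompact {P : Set (V → ℝ)} (hP : IsPolytope P) : IsCompact P := by
  obtain ⟨F, rfl⟩ := hP
  exact F.finite_toSet.isCompact_convexHull (𝕜 := ℝ)

theorem IsPolytope.convex {P : Set (V → ℝ)} (hP : IsPolytope P) : Convex ℝ P := by
  obtain ⟨F, rfl⟩ := hP
  exact convex_convexHull ℝ _

theorem isPolytope_convexHull_range {ι : Type*} [Finite ι] (f : ι → V → ℝ) :
    IsPolytope (convexHull ℝ (Set.range f)) :=
  ⟨(Set.finite_range f).toFinset, by simp⟩

theorem exists_isGreatest_dotProduct {P : Set (V → ℝ)} (hP : IsCompact P) (hne : P.Nonempty)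
    (w : V → ℝ) : ∃ m, IsGreatest ((w ⬝ᵥ ·) '' P) m := by
  refine (hP.image ?_).exists_isGreatest (hne.image _)
  unfold dotProduct
  fun_prop

theorem dotProduct_le_of_mem_segment {w a b y : V → ℝ} {m : ℝ} (hy : y ∈ segment ℝ a b)
    (ha : w ⬝ᵥ a ≤ m) (hb : w ⬝ᵥ b ≤ m) : w ⬝ᵥ y ≤ m := by
  obtain ⟨s, t, hs, ht, hst, rfl⟩ := hy
  rw [dotProduct_add, dotProduct_smul, dotProduct_smul, smul_eq_mul, smul_eq_mul]
  calc _ ≤ s * m + t * m :=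
        add_le_add (mul_le_mul_of_nonneg_left ha hs) (mul_le_mul_of_nonneg_left hb ht)
    _ = m := by rw [← add_mul, hst, one_mul]

variable (G : SimpleGraph V) [DecidableRel G.Adj]

theorem mem_graphicalZonotope {z : V → ℝ} : z ∈ graphicalZonotope G ↔
    ∃ g : Sym2 V → V → ℝ, (∀ e ∈ G.edgeFinset, g e ∈ edgeSegment e) ∧
      ∑ e ∈ G.edgeFinset, g e = z := by
  simp [graphicalZonotope, Set.mem_finsetSum]

theorem exists_forall_dotProduct_le_graphicalZonotope (W : Set (V → ℝ))
    (hW : ∀ u v, G.Adj u v → (∀ w ∈ W, w u ≤ w v) ∨ (∀ w ∈ W, w v ≤ w u)) :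
    ∃ z ∈ graphicalZonotope G, ∀ w ∈ W, ∀ x ∈ graphicalZonotope G, w ⬝ᵥ x ≤ w ⬝ᵥ z := by
  have key : ∀ e : Sym2 V, ∃ y, e ∈ G.edgeFinset →
      y ∈ edgeSegment e ∧ ∀ w ∈ W, ∀ x ∈ edgeSegment e, w ⬝ᵥ x ≤ w ⬝ᵥ y := by
    intro e
    induction e with | _ u v
    by_cases huv : G.Adj u v
    · rcases hW u v huv with h | h
      · refine ⟨Pi.single v 1, fun _ => ⟨right_mem_segment ℝ _ _, fun w hw x hx => ?_⟩⟩
        exact dotProduct_le_of_mem_segment hx (by simpa using h w hw) le_rfl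
      · refine ⟨Pi.single u 1, fun _ => ⟨left_mem_segment ℝ _ _, fun w hw x hx => ?_⟩⟩
        exact dotProduct_le_of_mem_segment hx le_rfl (by simpa using h w hw)
    · exact ⟨0, fun he => absurd (by simpa using he) huv⟩
  choose g hg using key
  refine ⟨_, (mem_graphicalZonotope G).2 ⟨g, fun e he => (hg e he).1, rfl⟩, ?_⟩
  intro w hw x hx
  obtain ⟨g', hg', rfl⟩ := (mem_graphicalZonotope G).1 hx
  rw [dotProduct_sum, dotProduct_sum]
  exact Finset.sum_le_sum fun e he => (hg e he).2 w hw _ (hg' e he)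

/-- Splitting a maximizer of a Minkowski sum as `p + q` forces `p` to be a maximizer on `P`: replace
`p` by `x` and keep `q`. -/
theorem exists_forall_dotProduct_le_summand {P Q : Set (V → ℝ)} {c : ℝ} (hc : 0 ≤ c)
    (hPQ : P + Q = c • graphicalZonotope G) (W : Set (V → ℝ))
    (hW : ∀ u v, G.Adj u v → (∀ w ∈ W, w u ≤ w v) ∨ (∀ w ∈ W, w v ≤ w u)) :
    ∃ p ∈ P, ∀ w ∈ W, ∀ x ∈ P, w ⬝ᵥ x ≤ w ⬝ᵥ p := by
  obtain ⟨z, hz, hmax⟩ := exists_forall_dotProduct_le_graphicalZonotope G W hW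
  obtain ⟨p, hp, q, hq, hpq⟩ : c • z ∈ P + Q := hPQ ▸ Set.smul_mem_smul_set hz
  refine ⟨p, hp, fun w hw x hx => ?_⟩
  obtain ⟨z', hz', hxq⟩ : x + q ∈ c • graphicalZonotope G := hPQ ▸ Set.add_mem_add hx hq
  have h1 : w ⬝ᵥ (x + q) ≤ w ⬝ᵥ (p + q) := by
    simp only at hpq hxq
    rw [hpq, ← hxq, dotProduct_smul, dotProduct_smul]
    exact smul_le_smul_of_nonneg_left (hmax w hw z' hz') hc
  rw [dotProduct_add, dotProduct_add] at h1
  linarith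

/-! ### Weak summands are deformed permutahedra -/

theorem signVector_dotProduct_add_union {S : Finset V} {u v : V} (huv : u ≠ v) (hu : u ∉ S)
    (hv : v ∉ S) (x : V → ℝ) :
    signVector (S ∪ {u}) ⬝ᵥ x + signVector (S ∪ {v}) ⬝ᵥ x =
      signVector S ⬝ᵥ x + signVector (S ∪ {u, v}) ⬝ᵥ x := by
  rw [← add_dotProduct, ← add_dotProduct]
  congr 1
  ext a
  simp only [signVector, Pi.add_apply, Finset.mem_union, Finset.mem_singleton, Finset.mem_insert]
  by_cases h1 : a = u <;> by_cases h2 : a = v <;> by_cases h3 : a ∈ S <;> simp_all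

variable {G}

theorem mem_heightCone_of_isGreatest {P Q : Set (V → ℝ)} {c : ℝ} (hc : 0 ≤ c)
    (hPQ : P + Q = c • graphicalZonotope G) {h : Finset V → ℝ}
    (hh : ∀ S, IsGreatest ((signVector S ⬝ᵥ ·) '' P) (h S)) : h ∈ heightCone G := by
  have hle : ∀ S, ∀ x ∈ P, signVector S ⬝ᵥ x ≤ h S := fun S x hx => (hh S).2 ⟨x, hx, rfl⟩
  have heq : ∀ S, ∀ p ∈ P, (∀ x ∈ P, signVector S ⬝ᵥ x ≤ signVector S ⬝ᵥ p) →
      signVector S ⬝ᵥ p = h S := by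
    intro S p hp hmax
    refine le_antisymm (hle S p hp) ?_
    obtain ⟨x, hx, hxS⟩ := (hh S).1
    exact hxS ▸ hmax x hx
  have pair : ∀ S T : Finset V, (∀ u v, G.Adj u v →
      (signVector S u ≤ signVector S v ∧ signVector T u ≤ signVector T v) ∨
      (signVector S v ≤ signVector S u ∧ signVector T v ≤ signVector T u)) →
      ∃ p ∈ P, signVector S ⬝ᵥ p = h S ∧ signVector T ⬝ᵥ p = h T := by
    intro S T hST
    obtain ⟨p, hp, hmax⟩ := exists_forall_dotProduct_le_summand G hc hPQ
      {signVector S, signVector T} (by simpa using hST)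
    exact ⟨p, hp, heq S p hp (hmax _ (by simp)), heq T p hp (hmax _ (by simp))⟩
  refine ⟨?_, ?_, ?_⟩
  · obtain ⟨p, -, h1, h2⟩ := pair ∅ Finset.univ (by simp [signVector])
    rw [← h1, ← h2]
    simp [signVector_dotProduct]
  · intro u v huv hG S hu hv
    apply le_antisymm
    -- These two sign vectors order only the pair `u`, `v` oppositely, and it is not an edge.
    · obtain ⟨p, hp, h1, h2⟩ := pair (S ∪ {u}) (S ∪ {v}) (by
        intro a b hab
        simp only [signVector_le_iff, Finset.mem_union, Finset.mem_singleton]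
        have h1 : ¬ (a = u ∧ b = v) := by rintro ⟨rfl, rfl⟩; exact hG hab
        have h2 : ¬ (a = v ∧ b = u) := by rintro ⟨rfl, rfl⟩; exact hG hab.symm
        clear hh hle heq pair
        grind)
      rw [← h1, ← h2, signVector_dotProduct_add_union huv hu hv]
      exact add_le_add (hle _ p hp) (hle _ p hp)
    -- Sign vectors of nested sets never order a pair oppositely, so this direction needs no
    -- hypothesis on adjacency.
    · obtain ⟨p, hp, h1, h2⟩ := pair S (S ∪ {u, v}) (by
        intro a b _
        simp only [signVector_le_iff, Finset.mem_union]
        tauto)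
      rw [← h1, ← h2, ← signVector_dotProduct_add_union huv hu hv]
      exact add_le_add (hle _ p hp) (hle _ p hp)
  · intro u v hG S hu hv
    obtain ⟨p, hp, h1, h2⟩ := pair S (S ∪ {u, v}) (by
      intro a b _
      simp only [signVector_le_iff, Finset.mem_union]
      tauto)
    rw [← h1, ← h2, ← signVector_dotProduct_add_union hG.ne hu hv]
    exact add_le_add (hle _ p hp) (hle _ p hp)

theorem eq_deformedPermutahedron_of_isGreatest {P Q : Set (V → ℝ)} (hconv : Convex ℝ P)
    (hcl : IsClosed P) {c : ℝ} (hc : 0 ≤ c)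
    (hPQ : P + Q = c • graphicalZonotope G) {h : Finset V → ℝ}
    (hh : ∀ S, IsGreatest ((signVector S ⬝ᵥ ·) '' P) (h S)) : P = deformedPermutahedron h := by
  have hsub : P ⊆ deformedPermutahedron h := fun x hx =>
    mem_deformedPermutahedron.2 fun S => (hh S).2 ⟨x, hx, rfl⟩
  refine hsub.antisymm fun x hx => mem_of_forall_dotProduct_le hconv hcl fun w => ?_
  obtain ⟨e, he⟩ := exists_equiv_fin_antitone w
  have hmono : ∀ u v, e u ≤ e v → ∀ k,
      signVector (initialSegment e k) v ≤ signVector (initialSegment e k) u := by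
    intro u v huv k
    rw [Fin.le_def] at huv
    simp only [signVector, initialSegment, Finset.mem_filter, Finset.mem_univ, true_and]
    split_ifs <;> first | omega | norm_num
  obtain ⟨p, hp, hmax⟩ := exists_forall_dotProduct_le_summand G hc hPQ
    (Set.range fun k => signVector (initialSegment e k)) (by
      intro u v _
      rw [Set.forall_mem_range, Set.forall_mem_range]
      exact (le_total (e v) (e u)).imp (hmono v u) (hmono u v))
  refine ⟨p, hp, dotProduct_le_of_tight e (mem_heightCone_of_isGreatest hc hPQ hh).1 he
    (hsub hp) (fun k => ?_) hx⟩
  refine le_antisymm ((hh _).2 ⟨p, hp, rfl⟩) ?_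
  obtain ⟨y, hy, hyS⟩ := (hh (initialSegment e k)).1
  exact hyS ▸ hmax _ ⟨k, rfl⟩ y hy

/-! ### Greedy vectors -/

theorem submodular_of_mem_heightCone {h : Finset V → ℝ} (hh : h ∈ heightCone G) {u v : V}
    (huv : u ≠ v) {S : Finset V} (hu : u ∉ S) (hv : v ∉ S) :
    h S + h (S ∪ {u, v}) ≤ h (S ∪ {u}) + h (S ∪ {v}) := by
  by_cases hG : G.Adj u v
  · exact hh.2.2 u v hG S hu hv
  · exact (hh.2.1 u v huv hG S hu hv).ge

theorem diminishing_returns {h : Finset V → ℝ} (hh : h ∈ heightCone G) {A B : Finset V}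
    (hAB : A ⊆ B) {u : V} (hu : u ∉ B) :
    h (insert u B) - h B ≤ h (insert u A) - h A := by
  obtain ⟨C, rfl⟩ : ∃ C, B = A ∪ C := ⟨B, (Finset.union_eq_right.2 hAB).symm⟩
  clear hAB
  induction C using Finset.induction_on with
  | empty => simp
  | insert a C _ ih =>
    rw [Finset.union_insert] at hu ⊢
    obtain ⟨hua, huC⟩ := not_or.1 (fun h => hu (Finset.mem_insert.2 h))
    refine le_trans ?_ (ih huC)
    by_cases ha : a ∈ A ∪ C
    · rw [Finset.insert_eq_of_mem ha]
    · have := submodular_of_mem_heightCone hh hua huC ha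
      simp only [Finset.union_singleton, Finset.union_insert] at this
      linarith

/-- Feasibility of the greedy vector: each new element of `S` contributes half its marginal gain
over the whole initial segment, at most that over the smaller set `S ∩ initialSegment e k`. -/
theorem sum_greedyVector_inter_le {n : ℕ} {h : Finset V → ℝ} (hh : h ∈ heightCone G)
    (e : V ≃ Fin n) (S : Finset V) (k : ℕ) (hk : k ≤ n) :
    ∑ v ∈ S ∩ initialSegment e k, greedyVector h e v ≤
      (h (S ∩ initialSegment e k) - h ∅) / 2 := by
  induction k with
  | zero => simp [initialSegment_zero]
  | succ k ih =>
    have ih := ih (by omega)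
    have hs := initialSegment_succ e ⟨k, hk⟩
    have hn := symm_notMem_initialSegment e ⟨k, hk⟩
    simp only at hs hn
    by_cases hS : e.symm ⟨k, hk⟩ ∈ S
    · have hn' : e.symm ⟨k, hk⟩ ∉ S ∩ initialSegment e k := fun hm =>
        hn (Finset.mem_inter.1 hm).2
      have hd := diminishing_returns hh (Finset.inter_subset_right (s₁ := S)) hn
      rw [hs, Finset.inter_insert_of_mem hS, Finset.sum_insert hn']
      simp only [greedyVector, Equiv.apply_symm_apply, hs] at ih ⊢
      linarith
    · rwa [hs, Finset.inter_insert_of_notMem hS]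

theorem sum_greedyVector_initialSegment {n : ℕ} (h : Finset V → ℝ)
    (e : V ≃ Fin n) (k : ℕ) (hk : k ≤ n) :
    ∑ v ∈ initialSegment e k, greedyVector h e v = (h (initialSegment e k) - h ∅) / 2 := by
  induction k with
  | zero => simp [initialSegment_zero]
  | succ k ih =>
    have ih := ih (by omega)
    have hs := initialSegment_succ e ⟨k, hk⟩
    simp only at hs
    rw [hs, Finset.sum_insert (symm_notMem_initialSegment e ⟨k, hk⟩), ih]
    simp only [greedyVector, Equiv.apply_symm_apply, hs]
    ring

theorem sum_greedyVector {n : ℕ} {h : Finset V → ℝ} (h0 : h ∅ = - h Finset.univ)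
    (e : V ≃ Fin n) : ∑ v, greedyVector h e v = h Finset.univ := by
  have := sum_greedyVector_initialSegment h e n le_rfl
  rw [initialSegment_top] at this
  linarith

theorem greedyVector_mem {n : ℕ} {h : Finset V → ℝ} (hh : h ∈ heightCone G) (e : V ≃ Fin n) :
    greedyVector h e ∈ deformedPermutahedron h := by
  rw [mem_deformedPermutahedron]
  intro S
  have := sum_greedyVector_inter_le hh e S n le_rfl
  rw [initialSegment_top, Finset.inter_univ] at this
  rw [signVector_dotProduct', sum_greedyVector hh.1]
  linarith [hh.1]

theorem greedyVector_tight {n : ℕ} {h : Finset V → ℝ} (h0 : h ∅ = - h Finset.univ)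
    (e : V ≃ Fin n) (k : ℕ) :
    signVector (initialSegment e k) ⬝ᵥ greedyVector h e = h (initialSegment e k) := by
  -- Past `n` the segments are constantly the whole of `V`.
  have hmin : initialSegment e k = initialSegment e (min k n) := by
    ext v
    have := (e v).2
    simp [initialSegment]
  rw [hmin, signVector_dotProduct', sum_greedyVector h0,
    sum_greedyVector_initialSegment h e _ (min_le_right _ _)]
  linarith

theorem deformedPermutahedron_eq_convexHull {h : Finset V → ℝ} (hh : h ∈ heightCone G) :
    deformedPermutahedron h =
      convexHull ℝ (Set.range fun e : V ≃ Fin (Fintype.card V) => greedyVector h e) := by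
  have hpoly := isPolytope_convexHull_range
    fun e : V ≃ Fin (Fintype.card V) => greedyVector h e
  refine Set.Subset.antisymm (fun x hx => ?_)
    (convexHull_min (Set.range_subset_iff.2 fun e => greedyVector_mem hh e)
      (convex_deformedPermutahedron h))
  refine mem_of_forall_dotProduct_le hpoly.convex hpoly.isCompact.isClosed fun w => ?_
  obtain ⟨e, he⟩ := exists_equiv_fin_antitone w
  exact ⟨greedyVector h e, subset_convexHull ℝ _ ⟨e, rfl⟩,
    dotProduct_le_of_tight e hh.1 he (greedyVector_mem hh e) (greedyVector_tight hh.1 e) hx⟩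

theorem isPolytope_deformedPermutahedron {h : Finset V → ℝ} (hh : h ∈ heightCone G) :
    IsPolytope (deformedPermutahedron h) := by
  rw [deformedPermutahedron_eq_convexHull hh]
  exact isPolytope_convexHull_range _

/-- The greedy vector of `h₁ + h₂` is the sum of those of `h₁` and `h₂` for the same enumeration, so
every generator of the right side splits. -/
theorem deformedPermutahedron_add {h₁ h₂ : Finset V → ℝ} (hh₁ : h₁ ∈ heightCone G)
    (hh₂ : h₂ ∈ heightCone G) (hh : h₁ + h₂ ∈ heightCone G) :
    deformedPermutahedron h₁ + deformedPermutahedron h₂ = deformedPermutahedron (h₁ + h₂) := by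
  apply Set.Subset.antisymm
  · rintro _ ⟨x, hx, y, hy, rfl⟩
    rw [mem_deformedPermutahedron] at *
    intro S
    rw [dotProduct_add]
    exact add_le_add (hx S) (hy S)
  · rw [deformedPermutahedron_eq_convexHull hh]
    refine convexHull_min ?_
      ((convex_deformedPermutahedron h₁).add (convex_deformedPermutahedron h₂))
    rintro _ ⟨e, rfl⟩
    refine ⟨_, greedyVector_mem hh₁ e, _, greedyVector_mem hh₂ e, ?_⟩
    ext v
    simp only [greedyVector, Pi.add_apply]
    ring

/-! ### The height of the graphical zonotope -/

theorem exists_mem_sym2_iff {S : Finset V} {a b : V} :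
    (∃ x ∈ S, x ∈ s(a, b)) ↔ a ∈ S ∨ b ∈ S := by
  simp only [Sym2.mem_iff]
  grind

theorem isGreatest_edgeSegment (S : Finset V) (e : Sym2 V) :
    IsGreatest ((signVector S ⬝ᵥ ·) '' edgeSegment e) (if ∃ a ∈ S, a ∈ e then 1 else -1) := by
  induction e with | _ u v
  rw [if_congr exists_mem_sym2_iff rfl rfl]
  have hu : (signVector S ⬝ᵥ Pi.single u 1) = if u ∈ S then 1 else -1 := by
    simp [signVector]
  have hv : (signVector S ⬝ᵥ Pi.single v 1) = if v ∈ S then 1 else -1 := by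
    simp [signVector]
  have hlu : Pi.single u (1 : ℝ) ∈ edgeSegment s(u, v) := left_mem_segment ℝ _ _
  have hrv : Pi.single v (1 : ℝ) ∈ edgeSegment s(u, v) := right_mem_segment ℝ _ _
  constructor
  · by_cases h : v ∈ S
    · exact ⟨_, hrv, by simp [hv, h]⟩
    · exact ⟨_, hlu, by simp [hu, h]⟩
  · rintro _ ⟨y, hy, rfl⟩
    refine dotProduct_le_of_mem_segment hy ?_ ?_
    · rw [hu]
      by_cases h : u ∈ S <;> by_cases h' : v ∈ S <;> simp [h, h']
    · rw [hv]
      by_cases h : u ∈ S <;> by_cases h' : v ∈ S <;> simp [h, h']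

variable (G)

theorem isGreatest_graphicalZonotope (S : Finset V) :
    IsGreatest ((signVector S ⬝ᵥ ·) '' graphicalZonotope G) (zonotopeHeight G S) := by
  constructor
  · choose g hg hgS using fun e => (isGreatest_edgeSegment S e).1
    refine ⟨_, (mem_graphicalZonotope G).2 ⟨g, fun e _ => hg e, rfl⟩, ?_⟩
    simp only [dotProduct_sum, zonotopeHeight]
    exact Finset.sum_congr rfl fun e _ => hgS e
  · rintro _ ⟨z, hz, rfl⟩
    obtain ⟨g, hg, rfl⟩ := (mem_graphicalZonotope G).1 hz
    simp only [dotProduct_sum, zonotopeHeight]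
    exact Finset.sum_le_sum fun e he => (isGreatest_edgeSegment S e).2 ⟨_, hg e he, rfl⟩

theorem isGreatest_smul_graphicalZonotope {c : ℝ} (hc : 0 ≤ c) (S : Finset V) :
    IsGreatest ((signVector S ⬝ᵥ ·) '' (c • graphicalZonotope G)) (c * zonotopeHeight G S) := by
  obtain ⟨⟨z, hz, hzS⟩, hub⟩ := isGreatest_graphicalZonotope G S
  constructor
  · exact ⟨c • z, Set.smul_mem_smul_set hz, by simp only at hzS ⊢; rw [dotProduct_smul, hzS]; rfl⟩
  · rintro _ ⟨_, ⟨x, hx, rfl⟩, rfl⟩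
    simp only [dotProduct_smul]
    exact mul_le_mul_of_nonneg_left (hub ⟨x, hx, rfl⟩) hc

theorem convex_isCompact_graphicalZonotope :
    Convex ℝ (graphicalZonotope G) ∧ IsCompact (graphicalZonotope G) := by
  refine Finset.sum_induction _ (fun s : Set (V → ℝ) => Convex ℝ s ∧ IsCompact s)
    (fun a b ha hb => ⟨ha.1.add hb.1, ha.2.add hb.2⟩)
    ⟨convex_singleton 0, isCompact_singleton⟩ fun e _ => ?_
  induction e with | _ u v
  have : edgeSegment s(u, v) =
      segment ℝ (Pi.single u (1 : ℝ) : V → ℝ) (Pi.single v (1 : ℝ)) := rfl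
  rw [this]
  exact ⟨convex_segment _ _, by
    rw [← convexHull_pair]; exact (Set.toFinite _).isCompact_convexHull (𝕜 := ℝ)⟩

variable {G}

/-- Whether an edge meets `S` is a coverage function, so each edge contributes submodularly; the
edge `s(u, v)` itself contributes exactly `2`. -/
theorem two_le_zonotopeHeight_gap {u v : V} (huv : G.Adj u v) {S : Finset V} (hu : u ∉ S)
    (hv : v ∉ S) :
    zonotopeHeight G S + zonotopeHeight G (S ∪ {u, v}) + 2 ≤
      zonotopeHeight G (S ∪ {u}) + zonotopeHeight G (S ∪ {v}) := by
  have he : s(u, v) ∈ G.edgeFinset := by simpa using huv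
  have h2 : (2 : ℝ) = ∑ e ∈ G.edgeFinset, if e = s(u, v) then 2 else 0 := by
    rw [Finset.sum_ite_eq' , if_pos he]
  unfold zonotopeHeight
  rw [h2, ← Finset.sum_add_distrib, ← Finset.sum_add_distrib, ← Finset.sum_add_distrib]
  refine Finset.sum_le_sum fun e _ => ?_
  induction e with | _ a b
  simp only [exists_mem_sym2_iff]
  simp only [Finset.mem_union, Finset.mem_singleton, Finset.mem_insert,
    @or_or_or_comm (a ∈ S) _ (b ∈ S) _, @or_or_or_comm (a = u) _ (b = u) _]
  by_cases hab : s(a, b) = s(u, v)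
  · have : ¬ (a ∈ S ∨ b ∈ S) ∧ (a = u ∨ b = u) ∧ (a = v ∨ b = v) := by
      rcases Sym2.eq_iff.1 hab with ⟨rfl, rfl⟩ | ⟨rfl, rfl⟩ <;> simp [hu, hv]
    simp only [this, hab]
    norm_num
  · rw [if_neg hab]
    by_cases h1 : a ∈ S ∨ b ∈ S <;> by_cases h2 : a = u ∨ b = u <;>
      by_cases h3 : a = v ∨ b = v <;> simp only [h1, h2, h3] <;> norm_num

theorem smul_zonotopeHeight_sub_mem_heightCone {c : ℝ}
    (hZ : (fun S => c * zonotopeHeight G S) ∈ heightCone G) {h : Finset V → ℝ}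
    (hh : h ∈ heightCone G) (hc : 2 * ∑ S, |h S| ≤ c) :
    (fun S => c * zonotopeHeight G S - h S) ∈ heightCone G := by
  refine ⟨?_, ?_, ?_⟩
  · have h1 := hZ.1
    have h2 := hh.1
    simp only at h1 ⊢
    linarith
  · intro u v huv hG S hu hv
    have h1 := hZ.2.1 u v huv hG S hu hv
    have h2 := hh.2.1 u v huv hG S hu hv
    simp only at h1 ⊢
    linarith
  · intro u v hG S hu hv
    -- The defect of `h` involves four heights, so is at most `4 * ∑ S, |h S|`, which the gap `2 *
    -- c` absorbs.
    have hb : ∀ T, |h T| ≤ ∑ S, |h S| := fun T =>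
      Finset.single_le_sum (f := fun S => |h S|) (fun _ _ => abs_nonneg _) (Finset.mem_univ T)
    have hc0 : 0 ≤ c := by linarith [hb ∅, abs_nonneg (h ∅)]
    have h1 := mul_le_mul_of_nonneg_left (two_le_zonotopeHeight_gap hG hu hv) hc0
    have h2 := (abs_le.1 (hb S)).1
    have h3 := (abs_le.1 (hb (S ∪ {u, v}))).1
    have h4 := (abs_le.1 (hb (S ∪ {u}))).2
    have h5 := (abs_le.1 (hb (S ∪ {v}))).2
    simp only
    linarith

end

theorem mainTheorem6 {V : Type*} [Fintype V] [DecidableEq V] (G : SimpleGraph V)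
    [DecidableRel G.Adj] :
    deformationCone (graphicalZonotope G) =
      deformedPermutahedron '' {h : Finset V → ℝ |
        h ∅ = - h Finset.univ ∧
        (∀ u v : V, u ≠ v → ¬ G.Adj u v → ∀ S : Finset V, u ∉ S → v ∉ S →
          h (S ∪ {u}) + h (S ∪ {v}) = h S + h (S ∪ {u, v})) ∧
        (∀ u v : V, G.Adj u v → ∀ S : Finset V, u ∉ S → v ∉ S →
          h (S ∪ {u}) + h (S ∪ {v}) ≥ h S + h (S ∪ {u, v}))} := by
  change _ = deformedPermutahedron '' heightCone G
  apply Set.Subset.antisymm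
  · rintro P ⟨hP, c, hc, Q, -, hPQ⟩
    -- With no objectives, this only says that `P` is nonempty.
    obtain ⟨p, hp, -⟩ := exists_forall_dotProduct_le_summand G hc hPQ ∅ (by simp)
    choose h hh using fun S =>
      exists_isGreatest_dotProduct hP.isCompact ⟨p, hp⟩ (signVector S)
    exact ⟨h, mem_heightCone_of_isGreatest hc hPQ hh,
      (eq_deformedPermutahedron_of_isGreatest hP.convex hP.isCompact.isClosed hc hPQ hh).symm⟩
  · rintro _ ⟨h, hh, rfl⟩
    set c : ℝ := 2 * ∑ S, |h S| with hcdef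
    have hc : 0 ≤ c := mul_nonneg two_pos.le (Finset.sum_nonneg fun _ _ => abs_nonneg _)
    -- The trivial decomposition makes the dilated zonotope itself a weak summand, so the first
    -- inclusion's lemmas apply to it.
    have hZ0 : c • graphicalZonotope G + {0} = c • graphicalZonotope G := by simp
    obtain ⟨hconv, hcomp⟩ := convex_isCompact_graphicalZonotope G
    have hZmem := mem_heightCone_of_isGreatest hc hZ0 (isGreatest_smul_graphicalZonotope G hc)
    have hZ := eq_deformedPermutahedron_of_isGreatest (hconv.smul c) (hcomp.smul c).isClosed hc hZ0
      (isGreatest_smul_graphicalZonotope G hc)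
    have hQ := smul_zonotopeHeight_sub_mem_heightCone hZmem hh hcdef.ge
    have hsum : h + (fun S => c * zonotopeHeight G S - h S) =
        fun S => c * zonotopeHeight G S := by
      ext S
      simp
    refine ⟨isPolytope_deformedPermutahedron hh, c, hc, _, isPolytope_deformedPermutahedron hQ, ?_⟩
    rw [hZ, deformedPermutahedron_add hh hQ (hsum ▸ hZmem), hsum]
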